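/- **Trees.** Let $\Sigma$ be an alphabet. For a set $X$ let $T_\Sigma X$ be the set of complete binary trees with inner nodes labelled in $\Sigma$ and finitely many leaves, all labelled in $X$: that is, functions $t:P\to\Sigma+X$ with $P=\mathrm{dom}(t)\subseteq\{l,r\}^*$ non-empty and prefix closed, where every $w\in P$ either has both children $wl,wr$ in $P$ (an inner node, and then $t(w)\in\Sigma$) or has neither (a leaf, and then $t(w)\in X$), and where the number of leaves is finite. The tree $t$ is finite if its height is finite, and infinite if $\mathrm{dom}(t)=\{l,r\}^*$. Trees of height $0$ give an inclusion $X\subseteq T_\Sigma X$, and trees of height $1$ an inclusion $\Sigma\times X\times X\subseteq T_\Sigma X$. **The theory $\mathsf{TTS}^\omega$.** Its objects are the sets $n=\{1,\dots,n\}$, $n\ge 0$. Its morphisms $f:n\rightharpoondown m$ are the maps $f:n\to\mathcal P(T_\Sigma m)$, ordered by pointwise inclusion, so that each hom-set is a complete lattice. The composite $g\cdot f$ sends $x$ to the set of all trees obtained from a tree in $f(x)$ by replacing each occurrence of a leaf $y$ by a tree from $g(y)$, where the replacements at different occurrences are chosen independently. The identity is $\mathsf{id}(i)=\{i\}$, and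 $!:n\rightharpoondown 1$ is $!(i)=\{1\}$. For an endomorphism $\beta:n\rightharpoondown n$ let $\beta^*:n\rightharpoondown n$ be the least fixpoint of $x\mapsto\mathsf{id}\vee x\cdot\beta$, let $\beta^+=\beta^*\cdot\beta$, and let $\beta^\omega:n\rightharpoondown 0$ be the greatest fixpoint of $x\mapsto x\cdot\beta$. **Automata.** Let $(n,\Sigma,\delta,\mathfrak F)$ be a non-deterministic tree automaton, i.e. $\delta:n\times\Sigma\to\mathcal P(n\times n)$ and $\mathfrak F\subseteq n$. Let $\alpha:n\to\mathcal P(\Sigma\times n\times n)$, $\alpha(i)=\{(a,j,k)\mid (j,k)\in\delta(i,a)\}$, be viewed as an endomorphism $\alpha:n\rightharpoondown n$ in $\mathsf{TTS}^\omega$ through $\Sigma\times n\times n\subseteq T_\Sigma n$. Let $\mathfrak{f_F}:n\rightharpoondown n$ be given by $\mathfrak{f_F}(i)=\{i\}$ if $i\in\mathfrak F$ and $\mathfrak{f_F}(i)=\varnothing$ otherwise. A run on a tree $t$ starting at $i$ is a map $\mathfrak r:\mathrm{dom}(t)\to n$ with $\mathfrak r(\varepsilon)=i$ and $(\mathfrak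 r(wl),\mathfrak r(wr))\in\delta(\mathfrak r(w),t(w))$ for every inner node $w$ of $t$. - A finite tree $t\in T_\Sigma 1$ is recognized by $i$ if there is a run $\mathfrak r$ on $t$ starting at $i$ with $\mathfrak r(w)\in\mathfrak F$ for every leaf $w$ of $t$. - An infinite tree $t\in T_\Sigma\varnothing$ is recognized by $i$ (Büchi condition) if there is a run $\mathfrak r$ on $t$ starting at $i$ such that on every infinite branch of $\{l,r\}^*$ a state from $\mathfrak F$ occurs infinitely often. **Proposition.** For every $i\in n$: $$(!\cdot\mathfrak{f_F}\cdot\alpha^*)(i)=\{t\in T_\Sigma 1\mid t\text{ is finite and recognized by }i\},$$ $$(\mathfrak{f_F}\cdot\alpha^+)^\omega(i)=\{t\in T_\Sigma\varnothing\mid t\text{ is infinite and recognized by }i\}.$$ -/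

import Mathlib

namespace TreeTTS

universe u v w x

/-- The set `T_A X` of complete binary trees with inner nodes labelled in the alphabet `A` and
finitely many leaves, all labelled in `X`.  Nodes are words over `{l, r}`, written as lists of
Booleans (`false` is `l`, `true` is `r`); the child of `p` in direction `b` is `p ++ [b]`.
The partial function `P → A + X` is `label`, with value `none` outside its domain `P`.
The field `child_iff` says that `P` is prefix closed and the tree complete (a child of `p` is
a node only if `p` is, and `p` has either two or no children), that nodes with children are
labelled in `A`, and that nodes without children are labelled in `X`. -/
@[ext]
structure TTree (A : Type u) (X : Type v) where
  label : List Bool → Option (A ⊕ X)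
  root_mem : label [] ≠ none
  child_iff : ∀ (p : List Bool) (b : Bool),
    label (p ++ [b]) ≠ none ↔ ∃ a, label p = some (Sum.inl a)
  finite_leaves : {p | ∃ y, label p = some (Sum.inr y)}.Finite

namespace TTree

variable {A : Type u} {X : Type v}

/-- The set of nodes of a tree. -/
def dom (t : TTree A X) : Set (List Bool) := {p | t.label p ≠ none}

/-- A tree is finite if its height is finite. -/
def IsFinite (t : TTree A X) : Prop := ∃ N : ℕ, ∀ p ∈ t.dom, p.length ≤ N

/-- A tree is infinite if every word over `{l, r}` is a node. -/
def IsInfinite (t : TTree A X) : Prop := t.dom = Set.univ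

/-- The tree of height `0` whose only node is labelled `y`; this is the inclusion
`X ⊆ T_A X`, the unit of the monad `T_A`. -/
def leaf (y : X) : TTree A X where
  label
    | [] => some (Sum.inr y)
    | _ :: _ => none
  root_mem := by simp
  child_iff := by
    intro p b
    cases p <;> simp
  finite_leaves := by
    refine (Set.finite_singleton ([] : List Bool)).subset ?_
    rintro (_ | ⟨b, p⟩) ⟨z, hz⟩
    · rfl
    · simp at hz

/-- The tree of height `1` with root `a`, left leaf `y` and right leaf `z`; this is the
inclusion `A × X × X ⊆ T_A X`. -/
def node (a : A) (y z : X) : TTree A X where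
  label
    | [] => some (Sum.inl a)
    | [false] => some (Sum.inr y)
    | [true] => some (Sum.inr z)
    | _ :: _ :: _ => none
  root_mem := by simp
  child_iff := by
    intro p b
    rcases p with _ | ⟨c, _ | ⟨d, p⟩⟩
    · cases b <;> simp
    · cases c <;> simp
    · simp
  finite_leaves := by
    refine (Set.toFinite ({[false], [true]} : Set (List Bool))).subset ?_
    rintro (_ | ⟨c, _ | ⟨d, p⟩⟩) ⟨z, hz⟩
    · simp at hz
    · cases c <;> simp
    · simp at hz

end TTree

/-- Morphisms `X ⇸ Y` of the Kleisli category of the monad `𝒫 T_A`, i.e. maps `X → 𝒫 (T_A Y)`.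
They are ordered by pointwise inclusion, which makes every hom-set a complete lattice.
The theory `TTS^ω` is the full subcategory on the sets `Fin n`, `n = 0, 1, …`. -/
abbrev Hom (A : Type u) (X : Type v) (Y : Type w) : Type (max v u w) := X → Set (TTree A Y)

section Kleisli

variable {A : Type u} {X : Type v} {Y : Type w} {Z : Type x}

/-- Kleisli composition `g · f`: the set `(g · f)(x)` consists of the trees `s` obtained from a
tree `t ∈ f x` by replacing every occurrence of a leaf, with label `y` say, by a tree from `g y`
(different occurrences of the same `y` may be replaced by different trees of `g y`). -/
def comp (g : Hom A Y Z) (f : Hom A X Y) : Hom A X Z := fun i =>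
  {s | ∃ t ∈ f i,
    (∀ p a, t.label p = some (Sum.inl a) → s.label p = some (Sum.inl a)) ∧
    ∀ p y, t.label p = some (Sum.inr y) → ∃ t' ∈ g y, ∀ q, s.label (p ++ q) = t'.label q}

/-- The base morphism `f^♯` of a map `f`. -/
def sharp (f : X → Y) : Hom A X Y := fun i => {TTree.leaf (f i)}

/-- The identity morphism. -/
def ident (A : Type u) (X : Type v) : Hom A X X := sharp id

theorem comp_mono {g g' : Hom A Y Z} {f f' : Hom A X Y} (hg : g ≤ g') (hf : f ≤ f') :
    comp g f ≤ comp g' f' := by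
  rintro i s ⟨t, ht, h1, h2⟩
  refine ⟨t, hf i ht, h1, fun p y hp => ?_⟩
  obtain ⟨t', ht', h⟩ := h2 p y hp
  exact ⟨t', hg y ht', h⟩

/-- `α^* = μ x. (id ∨ x · α)`, the least fixpoint. -/
def star (α : Hom A X X) : Hom A X X :=
  OrderHom.lfp ⟨fun x => ident A X ⊔ comp x α,
    fun _ _ h => sup_le_sup_left (comp_mono h le_rfl) _⟩

/-- `α^+ = α^* · α`. -/
def plus (α : Hom A X X) : Hom A X X := comp (star α) α

/-- `β^ω : X ⇸ 0` is the greatest fixpoint of `x ↦ x · β`. -/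
def omega (β : Hom A X X) : Hom A X (Fin 0) :=
  OrderHom.gfp ⟨fun x => comp x β, fun _ _ h => comp_mono h le_rfl⟩

/-- The morphism `! : X ⇸ 1`. -/
def bang (A : Type u) (X : Type v) : Hom A X (Fin 1) := sharp fun _ => 0

/-- The endomorphism `f_F` encoding a set `F` of accepting states: it maps `i` to `{i}` if
`i ∈ F` and to `∅` otherwise. -/
def accept (A : Type u) (F : Set X) : Hom A X X := fun i => {t | i ∈ F ∧ t = TTree.leaf i}

end Kleisli

/-- A nondeterministic (Büchi) tree automaton over the alphabet `A` with state space
`n = {1, …, n}` and no distinguished initial state. -/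
structure TreeAutomaton (A : Type u) (n : ℕ) where
  δ : Fin n → A → Set (Fin n × Fin n)
  final : Set (Fin n)

namespace TreeAutomaton

variable {A : Type u} {n : ℕ} {X : Type v}

/-- The transition map `α : n → 𝒫 (A × n × n)`. -/
def trans (M : TreeAutomaton A n) (i : Fin n) : Set (A × Fin n × Fin n) :=
  {c | (c.2.1, c.2.2) ∈ M.δ i c.1}

/-- The transition map viewed as an endomorphism of `n` in `TTS^ω`, along the inclusion
`𝒫 (A × n × n) ⊆ 𝒫 (T_A n)`. -/
def transHom (M : TreeAutomaton A n) : Hom A (Fin n) (Fin n) := fun i =>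
  (fun c : A × Fin n × Fin n => TTree.node c.1 c.2.1 c.2.2) '' M.trans i

/-- `ρ` is a run of the automaton on the tree `t` starting at `i`.  Only the values of `ρ` at the
nodes of `t` matter. -/
def IsRun (M : TreeAutomaton A n) (t : TTree A X) (i : Fin n) (ρ : List Bool → Fin n) : Prop :=
  ρ [] = i ∧ ∀ p a, t.label p = some (Sum.inl a) →
    (ρ (p ++ [false]), ρ (p ++ [true])) ∈ M.δ (ρ p) a

/-- The finite trees recognized from `i`: there is a run all of whose leaf states are
accepting. -/
def finiteTrees (M : TreeAutomaton A n) (i : Fin n) : Set (TTree A (Fin 1)) :=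
  {t | t.IsFinite ∧ ∃ ρ, M.IsRun t i ρ ∧ ∀ p y, t.label p = some (Sum.inr y) → ρ p ∈ M.final}

/-- The infinite trees recognized from `i`: there is a run that visits accepting states
infinitely often along every infinite branch `b : ℕ → {l, r}`. -/
def infiniteTrees (M : TreeAutomaton A n) (i : Fin n) : Set (TTree A (Fin 0)) :=
  {t | t.IsInfinite ∧ ∃ ρ, M.IsRun t i ρ ∧
    ∀ b : ℕ → Bool, ∃ᶠ k in Filter.atTop, ρ ((List.range k).map b) ∈ M.final}

end TreeAutomaton

end TreeTTS

/-! Morphisms are sets of tree fragments, and composition grafts fragments at leaves independently.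
Iterating the one-step fragments of α finitely often gives exactly the finite trees whose leaves
carry the leaf states of a run (`star_transHom`). Filtering leaves by 𝔉 and forgetting their labels
yields the first equation; `mem_comp_accept_plus` likewise identifies `𝔣·α⁺` with finite pieces of
positive height whose runs end in accepting leaf states.

For the second equation, ⊇ is coinduction: cut a Büchi run at the first accepting positions below
the root. König's lemma makes the piece finite, and the subtrees hanging below it are again
recognized (`infiniteTrees_le_comp`). For ⊆, unfolding the greatest fixpoint supplies pieces. A run
is threaded through them together with a bound on the remaining height of the current piece; the
bound drops at every step that does not enter 𝔉, so no branch avoids 𝔉 forever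
(`omega_le_infiniteTrees`). -/

namespace TreeTTS

universe u v w x

/-! ### Leaves, subtrees and relabelling -/

namespace TTree

variable {A : Type u} {X : Type v} {Y : Type w}

theorem label_append_cons_ne_none (t : TTree A X) {p : List Bool} {b : Bool} {q : List Bool}
    (h : t.label (p ++ b :: q) ≠ none) : t.label (p ++ [b]) ≠ none := by
  induction q using List.reverseRecOn with
  | nil => exact h
  | append_singleton q c ih =>
    apply ih
    have h' : t.label ((p ++ b :: q) ++ [c]) ≠ none := by simpa using h
    obtain ⟨a, ha⟩ := (t.child_iff _ c).1 h'
    simp [ha]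

theorem exists_inl_of_label_append (t : TTree A X) {p : List Bool} {b : Bool} {q : List Bool}
    (h : t.label (p ++ b :: q) ≠ none) : ∃ a, t.label p = some (Sum.inl a) :=
  (t.child_iff p b).1 (t.label_append_cons_ne_none h)

/-- Below a leaf there are no nodes. -/
theorem label_append_leaf (t : TTree A X) {p : List Bool} {y : X}
    (h : t.label p = some (Sum.inr y)) (b : Bool) (q : List Bool) :
    t.label (p ++ b :: q) = none := by
  by_contra hne
  obtain ⟨a, ha⟩ := t.exists_inl_of_label_append hne
  simp [h] at ha

/-- Every word is an inner node or extends a leaf. -/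
theorem inner_or_extends_leaf (t : TTree A X) (p : List Bool) :
    (∃ a, t.label p = some (Sum.inl a)) ∨
      ∃ q r y, p = q ++ r ∧ t.label q = some (Sum.inr y) := by
  induction p using List.reverseRecOn with
  | nil =>
    rcases h : t.label [] with _ | a | y
    · exact absurd h t.root_mem
    · exact Or.inl ⟨a, rfl⟩
    · exact Or.inr ⟨[], [], y, rfl, h⟩
  | append_singleton p b ih =>
    rcases ih with hp | ⟨q, r, y, rfl, hq⟩
    · rcases h : t.label (p ++ [b]) with _ | a | y
      · exact absurd h ((t.child_iff p b).2 hp)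
      · exact Or.inl ⟨a, rfl⟩
      · exact Or.inr ⟨p ++ [b], [], y, by simp, h⟩
    · exact Or.inr ⟨q, r ++ [b], y, by simp, hq⟩

/-- A tree without leaf labels consists of inner nodes only. -/
theorem exists_label_eq_inl [IsEmpty X] (t : TTree A X) (p : List Bool) :
    ∃ a, t.label p = some (Sum.inl a) := by
  rcases t.inner_or_extends_leaf p with h | ⟨_, _, y, _⟩
  · exact h
  · exact isEmptyElim y

theorem isInfinite [IsEmpty X] (t : TTree A X) : t.IsInfinite := by
  refine Set.eq_univ_of_forall fun p => ?_
  obtain ⟨a, ha⟩ := t.exists_label_eq_inl p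
  simp [dom, ha]

theorem leaf_label_nil (y : X) : (leaf y : TTree A X).label [] = some (Sum.inr y) := rfl

theorem leaf_label_cons (y : X) (b : Bool) (p : List Bool) :
    (leaf y : TTree A X).label (b :: p) = none := rfl

theorem eq_leaf (t : TTree A X) {y : X} (h : t.label [] = some (Sum.inr y)) : t = leaf y := by
  ext1
  funext p
  cases p with
  | nil => exact h
  | cons b p => exact t.label_append_leaf h b p

/-- The subtree rooted at a node. -/
def subtree (t : TTree A X) (p : List Bool) (hp : t.label p ≠ none) : TTree A X where
  label q := t.label (p ++ q)
  root_mem := by simpa using hp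
  child_iff q b := by rw [← List.append_assoc]; exact t.child_iff (p ++ q) b
  finite_leaves :=
    t.finite_leaves.preimage (f := fun q => p ++ q) (List.append_right_injective p).injOn

/-- Replace the label of every leaf by a label depending on the position of the leaf. -/
def relabel (t : TTree A X) (ρ : List Bool → Y) : TTree A Y where
  label p := (t.label p).map (Sum.map id fun _ => ρ p)
  root_mem := by simpa using t.root_mem
  child_iff p b := by
    have h := t.child_iff p b
    rcases h1 : t.label p with _ | a | y <;> simp_all
  finite_leaves := by
    refine t.finite_leaves.subset ?_
    rintro p ⟨y, hy⟩
    rcases h1 : t.label p with _ | a | z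
    · simp [h1] at hy
    · simp [h1] at hy
    · exact ⟨z, h1⟩

theorem relabel_eq_inl {t : TTree A X} {ρ : List Bool → Y} {p : List Bool} {a : A} :
    (t.relabel ρ).label p = some (Sum.inl a) ↔ t.label p = some (Sum.inl a) := by
  rcases h : t.label p with _ | a | z <;> simp [relabel, h]

theorem relabel_eq_inr {t : TTree A X} {ρ : List Bool → Y} {p : List Bool} {y : Y} :
    (t.relabel ρ).label p = some (Sum.inr y) ↔
      (∃ z, t.label p = some (Sum.inr z)) ∧ ρ p = y := by
  rcases h : t.label p with _ | a | z <;> simp [relabel, h]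

theorem dom_relabel (t : TTree A X) (ρ : List Bool → Y) : (t.relabel ρ).dom = t.dom := by
  ext p
  simp [dom, relabel]

end TTree

/-! ### Composition with leaf morphisms; fixpoint laws -/

section Kleisli

variable {A : Type u} {X : Type v} {Y : Type w} {Z : Type x}

/-- Replacing every leaf `y` by the leaf `h y` relabels the tree along `h`. -/
theorem label_eq_map_of_leaf_tails {t : TTree A Y} {s : TTree A Z} {h : Y → Z}
    (h1 : ∀ p a, t.label p = some (Sum.inl a) → s.label p = some (Sum.inl a))
    (h2 : ∀ p y, t.label p = some (Sum.inr y) →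
      ∀ q, s.label (p ++ q) = (TTree.leaf (h y) : TTree A Z).label q) (p : List Bool) :
    s.label p = (t.label p).map (Sum.map id h) := by
  rcases t.inner_or_extends_leaf p with ⟨a, ha⟩ | ⟨q, r, y, rfl, hq⟩
  · simp [ha, h1 p a ha]
  · rw [h2 q y hq r]
    cases r with
    | nil => simp [hq, TTree.leaf_label_nil]
    | cons b r => simp [t.label_append_leaf hq, TTree.leaf_label_cons]

theorem mem_comp_sharp {h : Y → Z} {f : Hom A X Y} {i : X} {s : TTree A Z} :
    s ∈ comp (sharp h) f i ↔ ∃ t ∈ f i, ∀ p, s.label p = (t.label p).map (Sum.map id h) := by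
  constructor
  · rintro ⟨t, ht, h1, h2⟩
    refine ⟨t, ht, label_eq_map_of_leaf_tails h1 fun p y hp q => ?_⟩
    obtain ⟨_, rfl, h'⟩ := h2 p y hp
    exact h' q
  · rintro ⟨t, ht, hs⟩
    refine ⟨t, ht, fun p a hp => by simp [hs, hp], fun p y hp => ⟨_, rfl, fun q => ?_⟩⟩
    cases q with
    | nil => simp [hs, hp, TTree.leaf_label_nil]
    | cons b q => simp [hs, t.label_append_leaf hp, TTree.leaf_label_cons]

/-- Composing with `accept A F` keeps the trees all of whose leaves are labelled in `F`. -/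
theorem mem_comp_accept {F : Set Y} {f : Hom A X Y} {i : X} {s : TTree A Y} :
    s ∈ comp (accept A F) f i ↔ s ∈ f i ∧ ∀ p y, s.label p = some (Sum.inr y) → y ∈ F := by
  constructor
  · rintro ⟨t, ht, h1, h2⟩
    have hst : s = t := by
      ext1
      funext p
      rw [label_eq_map_of_leaf_tails (h := id) h1 fun p y hp q => ?_]
      · simp
      · obtain ⟨_, ⟨-, rfl⟩, h'⟩ := h2 p y hp
        exact h' q
    subst hst
    refine ⟨ht, fun p y hp => ?_⟩
    obtain ⟨_, ⟨hy, -⟩, -⟩ := h2 p y hp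
    exact hy
  · rintro ⟨ht, hF⟩
    refine ⟨s, ht, fun _ _ hp => hp, fun p y hp => ⟨_, ⟨hF p y hp, rfl⟩, fun q => ?_⟩⟩
    cases q with
    | nil => simpa [TTree.leaf_label_nil] using hp
    | cons b q => exact s.label_append_leaf hp b q

theorem star_eq (α : Hom A X X) : star α = ident A X ⊔ plus α :=
  (OrderHom.map_lfp ⟨fun x => ident A X ⊔ comp x α,
    fun _ _ h => sup_le_sup_left (comp_mono h le_rfl) _⟩).symm

theorem star_le {α x : Hom A X X} (h : ident A X ⊔ comp x α ≤ x) : star α ≤ x :=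
  OrderHom.lfp_le _ h

theorem omega_eq (β : Hom A X X) : omega β = comp (omega β) β :=
  (OrderHom.map_gfp ⟨fun x => comp x β, fun _ _ h => comp_mono h le_rfl⟩).symm

theorem le_omega {β : Hom A X X} {x : Hom A X (Fin 0)} (h : x ≤ comp x β) : x ≤ omega β :=
  OrderHom.le_gfp _ h

end Kleisli

/-! ### Finite runs and `star` -/

namespace TreeAutomaton

variable {A : Type u} {n : ℕ}

/-- The finite trees whose leaf labels are the leaf states of some run starting at `i`. -/
def runTrees (M : TreeAutomaton A n) : Hom A (Fin n) (Fin n) := fun i =>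
  {t | t.IsFinite ∧ ∃ ρ, M.IsRun t i ρ ∧ ∀ p y, t.label p = some (Sum.inr y) → ρ p = y}

/-- Two runs below the children of a transition glue to one run. This is the pre-fixpoint property
that bounds `star` from above. -/
theorem comp_transHom_runTrees_le (M : TreeAutomaton A n) :
    comp M.runTrees M.transHom ≤ M.runTrees := by
  rintro i s ⟨_, ⟨⟨a, j, k⟩, hδ, rfl⟩, h1, h2⟩
  have hroot : s.label [] = some (Sum.inl a) := h1 [] a rfl
  obtain ⟨t0, ⟨⟨N0, hN0⟩, ρ0, ⟨hr0, hρ0⟩, hl0⟩, hs0⟩ := h2 [false] j rfl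
  obtain ⟨t1, ⟨⟨N1, hN1⟩, ρ1, ⟨hr1, hρ1⟩, hl1⟩, hs1⟩ := h2 [true] k rfl
  simp only [List.singleton_append] at hs0 hs1
  refine ⟨⟨max N0 N1 + 1, ?_⟩,
    fun p => match p with | [] => i | false :: q => ρ0 q | true :: q => ρ1 q, ⟨rfl, ?_⟩, ?_⟩
  · rintro (_ | ⟨_ | _, q⟩) hp
    · simp
    · have := hN0 q (by simpa [TTree.dom, hs0] using hp)
      simp; omega
    · have := hN1 q (by simpa [TTree.dom, hs1] using hp)
      simp; omega
  · rintro (_ | ⟨_ | _, q⟩) c hp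
    · obtain rfl : a = c := by simpa [hroot] using hp
      simpa [hr0, hr1, trans] using hδ
    · exact hρ0 q c (by rw [← hs0, hp])
    · exact hρ1 q c (by rw [← hs1, hp])
  · rintro (_ | ⟨_ | _, q⟩) y hp
    · simp [hroot] at hp
    · exact hl0 q y (by rw [← hs0, hp])
    · exact hl1 q y (by rw [← hs1, hp])

/-- Induction on the height bound: a tree is a leaf, or a transition followed by two lower subtrees
carrying the shifted runs. -/
theorem mem_star_of_height_le (M : TreeAutomaton A n) (N : ℕ) :
    ∀ (i : Fin n) (t : TTree A (Fin n)) (ρ : List Bool → Fin n), (∀ p ∈ t.dom, p.length ≤ N) →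
      M.IsRun t i ρ → (∀ p y, t.label p = some (Sum.inr y) → ρ p = y) →
      t ∈ star M.transHom i := by
  induction N with
  | zero =>
    intro i t ρ hN hρ hl
    rw [star_eq]
    refine Or.inl ?_
    rcases h : t.label [] with _ | a | y
    · exact absurd h t.root_mem
    · have := hN ([] ++ [false]) ((t.child_iff [] false).2 ⟨a, h⟩)
      simp at this
    · rw [t.eq_leaf h, ← hl [] y h, hρ.1]
      rfl
  | succ N ih =>
    intro i t ρ hN hρ hl
    rw [star_eq]
    rcases h : t.label [] with _ | a | y
    · exact absurd h t.root_mem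
    · refine Or.inr ⟨_, ⟨(a, ρ [false], ρ [true]), ?_, rfl⟩, ?_, ?_⟩
      · have := hρ.2 [] a h
        rw [hρ.1] at this
        exact this
      · rintro (_ | ⟨_ | _, _ | ⟨_, p⟩⟩) c hc
        · rw [h]; exact hc
        all_goals cases hc
      · have key : ∀ b : Bool, ∃ t' ∈ star M.transHom (ρ [b]),
            ∀ q, t.label ([b] ++ q) = t'.label q := fun b => by
          refine ⟨t.subtree [b] ((t.child_iff [] b).2 ⟨a, h⟩),
            ih _ _ (fun q => ρ ([b] ++ q)) (fun p hp => ?_) ⟨rfl, fun p c hc => ?_⟩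
              fun p y hp => hl _ y hp, fun q => rfl⟩
          · have := hN ([b] ++ p) hp
            simp at this
            omega
          · simpa using hρ.2 ([b] ++ p) c hc
        rintro (_ | ⟨_ | _, _ | ⟨_, p⟩⟩) y hy
        · cases hy
        · cases hy; exact key false
        · cases hy
        · cases hy; exact key true
        · cases hy
    · refine Or.inl ?_
      rw [t.eq_leaf h, ← hl [] y h, hρ.1]
      rfl

theorem star_transHom (M : TreeAutomaton A n) : star M.transHom = M.runTrees := by
  refine le_antisymm (star_le (sup_le ?_ M.comp_transHom_runTrees_le)) ?_
  · rintro i _ rfl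
    refine ⟨⟨0, ?_⟩, fun _ => i, ⟨rfl, ?_⟩, ?_⟩
    · rintro (_ | ⟨b, p⟩) hp
      · simp
      · exact absurd rfl hp
    · rintro (_ | ⟨b, p⟩) a h <;> cases h
    · rintro (_ | ⟨b, p⟩) a h <;> cases h
      rfl
  · rintro i t ⟨⟨N, hN⟩, ρ, hρ, hl⟩
    exact M.mem_star_of_height_le N i t ρ hN hρ hl

theorem mem_plus_transHom (M : TreeAutomaton A n) {i : Fin n} {t : TTree A (Fin n)} :
    t ∈ plus M.transHom i ↔ t ∈ M.runTrees i ∧ ∃ a, t.label [] = some (Sum.inl a) := by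
  rw [← star_transHom]
  constructor
  · intro h
    refine ⟨by rw [star_eq]; exact Or.inr h, ?_⟩
    obtain ⟨_, ⟨⟨a, j, k⟩, -, rfl⟩, h1, -⟩ := h
    exact ⟨a, h1 [] a rfl⟩
  · rintro ⟨h, a, ha⟩
    rw [star_eq] at h
    rcases h with rfl | h
    · cases ha
    · exact h

theorem comp_bang_accept_star (M : TreeAutomaton A n) (i : Fin n) :
    comp (bang A (Fin n)) (comp (accept A M.final) (star M.transHom)) i = M.finiteTrees i := by
  ext s
  rw [bang, mem_comp_sharp, star_transHom]
  simp only [mem_comp_accept]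
  constructor
  · rintro ⟨t, ⟨⟨⟨N, hN⟩, ρ, ⟨hi, hρ⟩, hl⟩, hF⟩, hs⟩
    refine ⟨⟨N, fun p hp => hN p ?_⟩, ρ, ⟨hi, fun p a hp => hρ p a ?_⟩, fun p y hp => ?_⟩
    · simpa [TTree.dom, hs] using hp
    · rcases h : t.label p with _ | c | z <;> simp_all
    · rcases h : t.label p with _ | c | z
      · simp [hs, h] at hp
      · simp [hs, h] at hp
      · rw [hl p z h]
        exact hF p z h
  · rintro ⟨⟨N, hN⟩, ρ, ⟨hi, hρ⟩, hF⟩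
    -- Writing the state of the run on each leaf recovers a preimage under `bang`.
    refine ⟨s.relabel ρ, ⟨⟨⟨N, by rwa [TTree.dom_relabel]⟩, ρ,
      ⟨hi, fun p a hp => hρ p a (TTree.relabel_eq_inl.1 hp)⟩,
      fun p y hp => (TTree.relabel_eq_inr.1 hp).2⟩, fun p y hp => ?_⟩, fun p => ?_⟩
    · obtain ⟨⟨z, hz⟩, rfl⟩ := TTree.relabel_eq_inr.1 hp
      exact hF p z hz
    · rcases h : s.label p with _ | a | y
      · simp [TTree.relabel, h]
      · simp [TTree.relabel, h]
      · simp [TTree.relabel, h]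
        exact Subsingleton.elim _ _

/-- The trees of `f_F · α^+`: finite trees of positive height with a run whose leaf states are
accepting and label the leaves. -/
theorem mem_comp_accept_plus (M : TreeAutomaton A n) {i : Fin n} {t : TTree A (Fin n)} :
    t ∈ comp (accept A M.final) (plus M.transHom) i ↔
      t.IsFinite ∧ (∃ a, t.label [] = some (Sum.inl a)) ∧ ∃ ρ, M.IsRun t i ρ ∧
        ∀ p y, t.label p = some (Sum.inr y) → ρ p = y ∧ y ∈ M.final := by
  rw [mem_comp_accept, mem_plus_transHom]
  constructor
  · rintro ⟨⟨⟨hN, ρ, hρ, hl⟩, ha⟩, hF⟩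
    exact ⟨hN, ha, ρ, hρ, fun p y hp => ⟨hl p y hp, hF p y hp⟩⟩
  · rintro ⟨hN, ha, ρ, hρ, hl⟩
    exact ⟨⟨⟨hN, ρ, hρ, fun p y hp => (hl p y hp).1⟩, ha⟩, fun p y hp => (hl p y hp).2⟩

end TreeAutomaton

/-! ### König's lemma and cutting infinite trees -/

/-- König's lemma for binary words: a prefix closed set of words of unbounded length contains
all the prefixes of some infinite branch. -/
theorem exists_length_bound_of_no_branch {D : Set (List Bool)}
    (hD : ∀ p q, p ++ q ∈ D → p ∈ D) (hb : ∀ b : ℕ → Bool, ∃ k, (List.range k).map b ∉ D) :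
    ∃ N, ∀ p ∈ D, p.length ≤ N := by
  by_contra! hN
  -- Words with arbitrarily long extensions in `D`; following such words builds the branch.
  let Big : List Bool → Prop := fun p => ∀ N, ∃ q, p ++ q ∈ D ∧ N < q.length
  have step : ∀ p, Big p → ∃ b, Big (p ++ [b]) := by
    intro p hp
    by_contra! h
    simp only [Big] at h
    push Not at h
    obtain ⟨N0, h0⟩ := h false
    obtain ⟨N1, h1⟩ := h true
    obtain ⟨q, hq, hl⟩ := hp (max N0 N1 + 1)
    rcases q with _ | ⟨_ | _, q⟩
    · simp at hl
    · have := h0 q (by simpa using hq)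
      simp at hl; omega
    · have := h1 q (by simpa using hq)
      simp at hl; omega
  choose! c hc using step
  let w : ℕ → List Bool := fun k => Nat.rec [] (fun _ p => p ++ [c p]) k
  have hw : ∀ k, Big (w k) := by
    intro k
    induction k with
    | zero => exact hN
    | succ k ih => exact hc _ ih
  have hmap : ∀ k, (List.range k).map (fun k => c (w k)) = w k := by
    intro k
    induction k with
    | zero => rfl
    | succ k ih => rw [List.range_succ, List.map_append, ih]; rfl
  obtain ⟨k, hk⟩ := hb fun k => c (w k)
  rw [hmap] at hk
  obtain ⟨q, hq, -⟩ := hw k 0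
  exact hk (hD _ _ hq)

/-- No non-empty proper prefix of `p` lies in `C`. -/
def Uncut (C : Set (List Bool)) (p : List Bool) : Prop :=
  ∀ q r, q ≠ [] → r ≠ [] → p = q ++ r → q ∉ C

theorem uncut_nil (C : Set (List Bool)) : Uncut C [] := by
  intro q r hq _ h
  exact absurd (List.append_eq_nil_iff.1 h.symm).1 hq

theorem Uncut.of_append {C : Set (List Bool)} {p q : List Bool} (h : Uncut C (p ++ q)) :
    Uncut C p := by
  rintro q' r hq hr rfl
  exact h q' (r ++ q) hq (by simp [hr]) (by simp)

theorem uncut_append_singleton {C : Set (List Bool)} {p : List Bool} {b : Bool} :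
    Uncut C (p ++ [b]) ↔ Uncut C p ∧ ¬ (p ≠ [] ∧ p ∈ C) := by
  constructor
  · exact fun h => ⟨h.of_append, fun hp => h p [b] hp.1 (by simp) rfl hp.2⟩
  · rintro ⟨h, hp⟩ q r hq hr heq
    obtain rfl | ⟨r', c, rfl⟩ := r.eq_nil_or_concat
    · exact absurd rfl hr
    · rw [List.concat_eq_append, ← List.append_assoc] at heq
      obtain ⟨rfl, -⟩ := List.append_inj' heq rfl
      rcases eq_or_ne r' [] with rfl | hr'
      · exact fun hC => hp ⟨by simpa using hq, by simpa using hC⟩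
      · exact h q r' hq hr' rfl

namespace TTree

variable {A : Type u} {X : Type v} {Y : Type w}

open Classical in
/-- Cut an infinite tree at the first positions below the root that lie in `C`, labelling the
resulting leaves by `ρ`. -/
noncomputable def cut [IsEmpty X] (s : TTree A X) (C : Set (List Bool)) (ρ : List Bool → Y)
    (hC : {p | Uncut C p}.Finite) : TTree A Y where
  label p :=
    if Uncut C p then
      -- The root stays an inner node even if it lies in `C`, since pieces of `plus` have positive
      -- height.
      if p ≠ [] ∧ p ∈ C then some (Sum.inr (ρ p))
      else (s.label p).map (Sum.map id fun _ => ρ p)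
    else none
  root_mem := by
    obtain ⟨a, ha⟩ := s.exists_label_eq_inl []
    simp [ha, uncut_nil]
  child_iff p b := by
    obtain ⟨a, ha⟩ := s.exists_label_eq_inl p
    obtain ⟨a', ha'⟩ := s.exists_label_eq_inl (p ++ [b])
    rw [uncut_append_singleton]
    by_cases h1 : Uncut C p <;> by_cases h2 : p ≠ [] ∧ p ∈ C
    · simp [h1, h2]
    · simp only [h1, h2, ha, ha']
      split_ifs <;> simp_all
    · simp [h1]
    · simp [h1]
  finite_leaves := by
    refine hC.subset ?_
    rintro p ⟨y, hy⟩
    by_contra h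
    simp [show ¬ Uncut C p from h] at hy

section Cut

variable [IsEmpty X] {s : TTree A X} {C : Set (List Bool)} {ρ : List Bool → Y}
  {hC : {p | Uncut C p}.Finite} {p : List Bool}

theorem uncut_of_mem_dom_cut (h : p ∈ (s.cut C ρ hC).dom) : Uncut C p := by
  by_contra h'
  exact h (if_neg h')

theorem label_of_cut_eq_inl {a : A} (h : (s.cut C ρ hC).label p = some (Sum.inl a)) :
    s.label p = some (Sum.inl a) := by
  obtain ⟨c, hc⟩ := s.exists_label_eq_inl p
  simp only [cut] at h
  split_ifs at h
  · simp at h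
  · simpa [hc] using h

theorem mem_of_cut_eq_inr {y : Y} (h : (s.cut C ρ hC).label p = some (Sum.inr y)) :
    p ∈ C ∧ ρ p = y := by
  obtain ⟨c, hc⟩ := s.exists_label_eq_inl p
  simp only [cut] at h
  split_ifs at h with h1 h2
  · exact ⟨h2.2, by simpa using h⟩
  · simp [hc] at h

theorem cut_label_nil : ∃ a, (s.cut C ρ hC).label [] = some (Sum.inl a) := by
  obtain ⟨a, ha⟩ := s.exists_label_eq_inl []
  exact ⟨a, by simp [cut, ha, uncut_nil]⟩

end Cut

end TTree

/-! ### Büchi runs and `omega` -/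

namespace TreeAutomaton

variable {A : Type u} {n : ℕ}

theorem infiniteTrees_le_comp (M : TreeAutomaton A n) :
    M.infiniteTrees ≤ comp M.infiniteTrees (comp (accept A M.final) (plus M.transHom)) := by
  rintro i s ⟨-, ρ, ⟨hi, hρ⟩, hb⟩
  let C : Set (List Bool) := {p | ρ p ∈ M.final}
  obtain ⟨N, hN⟩ : ∃ N, ∀ p ∈ {p | Uncut C p}, p.length ≤ N := by
    refine exists_length_bound_of_no_branch (fun p q h => Uncut.of_append h) fun b => ?_
    -- A visit at depth at least 1 is a genuine cut, so the prefix of length `k + 1` lies beyond it.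
    obtain ⟨k, hk, hF⟩ := Filter.frequently_atTop.1 (hb b) 1
    refine ⟨k + 1, fun h => ?_⟩
    rw [List.range_succ, List.map_append] at h
    exact (uncut_append_singleton.1 h).2 ⟨by simp; omega, hF⟩
  have hC : {p | Uncut C p}.Finite := (List.finite_length_le Bool N).subset hN
  refine ⟨s.cut C ρ hC, M.mem_comp_accept_plus.2
    ⟨⟨N, fun p hp => hN p (TTree.uncut_of_mem_dom_cut hp)⟩, TTree.cut_label_nil, ρ,
      ⟨hi, fun p a hp => hρ p a (TTree.label_of_cut_eq_inl hp)⟩, fun p y hp => ?_⟩,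
    fun p a hp => TTree.label_of_cut_eq_inl hp, fun p y hp => ?_⟩
  · obtain ⟨h, rfl⟩ := TTree.mem_of_cut_eq_inr hp
    exact ⟨rfl, h⟩
  · obtain ⟨-, rfl⟩ := TTree.mem_of_cut_eq_inr hp
    refine ⟨s.subtree p ?_, ⟨TTree.isInfinite _, fun q => ρ (p ++ q), ⟨by simp, ?_⟩, ?_⟩,
      fun q => rfl⟩
    · obtain ⟨a, ha⟩ := s.exists_label_eq_inl p
      simp [ha]
    · intro q a hq
      simpa using hρ (p ++ q) a hq
    · intro b
      refine Filter.frequently_atTop.2 fun K => ?_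
      -- Apply the Büchi condition to the branch that follows `p` and then `b`, beyond depth
      -- `p.length + K`.
      obtain ⟨k, hk, hF⟩ := Filter.frequently_atTop.1
        (hb fun k => if h : k < p.length then p[k] else b (k - p.length)) (p.length + K)
      obtain ⟨m, rfl⟩ := Nat.exists_eq_add_of_le ((Nat.le_add_right _ K).trans hk)
      refine ⟨m, by omega, ?_⟩
      convert hF using 2
      rw [List.range_add, List.map_append, List.map_map]
      congr 1
      · refine List.ext_getElem (by simp) fun k h1 h2 => ?_
        simp [h1]
      · simp [Function.comp_def]

/-- `M.Progress s p c` says that a run on the infinite tree `s` can be in state `c.1` at `p`,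
inside a finite piece of `s` all of whose leaf states are accepting, whose remaining height is
at most `c.2`, and below which `s` continues with trees of `ω`. -/
def Progress (M : TreeAutomaton A n) (s : TTree A (Fin 0)) (p : List Bool)
    (c : Fin n × ℕ) : Prop :=
  ∃ (r q : List Bool) (t : TTree A (Fin n)) (ρ : List Bool → Fin n) (N : ℕ),
    p = r ++ q ∧ (∀ p ∈ t.dom, p.length ≤ N) ∧
    (∀ p a, t.label p = some (Sum.inl a) →
      (ρ (p ++ [false]), ρ (p ++ [true])) ∈ M.δ (ρ p) a) ∧
    (∀ p y, t.label p = some (Sum.inr y) → ρ p = y ∧ y ∈ M.final) ∧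
    (∃ a, t.label q = some (Sum.inl a)) ∧ ρ q = c.1 ∧ N ≤ c.2 + q.length ∧
    (∀ p a, t.label p = some (Sum.inl a) → s.label (r ++ p) = some (Sum.inl a)) ∧
    ∀ p y, t.label p = some (Sum.inr y) →
      ∃ t' ∈ omega (comp (accept A M.final) (plus M.transHom)) y,
        ∀ q, s.label (r ++ p ++ q) = t'.label q

theorem exists_progress_of_tail (M : TreeAutomaton A n) {s : TTree A (Fin 0)} {p : List Bool}
    {j : Fin n} {t : TTree A (Fin 0)}
    (ht : t ∈ omega (comp (accept A M.final) (plus M.transHom)) j)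
    (hs : ∀ q, s.label (p ++ q) = t.label q) : ∃ m, M.Progress s p (j, m) := by
  rw [omega_eq] at ht
  obtain ⟨u, hu, h1, h2⟩ := ht
  obtain ⟨⟨N, hN⟩, hroot, ρ, ⟨hj, hρ⟩, hl⟩ := M.mem_comp_accept_plus.1 hu
  refine ⟨N, p, [], u, ρ, N, by simp, hN, hρ, hl, hroot, hj, by simp,
    fun q a hq => by rw [hs]; exact h1 q a hq, fun q y hq => ?_⟩
  obtain ⟨t', ht', h'⟩ := h2 q y hq
  exact ⟨t', ht', fun q' => by rw [List.append_assoc, hs, h']⟩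

/-- An inner child stays in the piece and lowers the bound; a leaf child is accepting and starts a
new piece with a fresh bound. The witnessing piece may change between steps, so only the state and
the bound are remembered. -/
theorem Progress.step {M : TreeAutomaton A n} {s : TTree A (Fin 0)} {p : List Bool}
    {c : Fin n × ℕ} (h : M.Progress s p c) :
    ∃ d : Bool → Fin n × ℕ, (∀ b, M.Progress s (p ++ [b]) (d b)) ∧
      (∀ a, s.label p = some (Sum.inl a) → ((d false).1, (d true).1) ∈ M.δ c.1 a) ∧
      ∀ b, (d b).2 < c.2 ∨ (d b).1 ∈ M.final := by
  obtain ⟨r, q, t, ρ, N, rfl, hN, hρ, hl, ⟨a, ha⟩, hj, hm, hs1, hs2⟩ := h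
  have key : ∀ b, ∃ m, M.Progress s (r ++ q ++ [b]) (ρ (q ++ [b]), m) ∧
      (m < c.2 ∨ ρ (q ++ [b]) ∈ M.final) := by
    intro b
    rcases hb : t.label (q ++ [b]) with _ | a' | y
    · exact absurd hb ((t.child_iff q b).2 ⟨a, ha⟩)
    · have hlen : (q ++ [b]).length ≤ N := hN _ (by simp [TTree.dom, hb])
      simp only [List.length_append, List.length_singleton] at hlen
      -- The subtraction does not truncate: `q.length + 1 ≤ N ≤ c.2 + q.length` forces `c.2 ≥ 1`.
      exact ⟨c.2 - 1, ⟨r, q ++ [b], t, ρ, N, by simp, hN, hρ, hl, ⟨a', hb⟩, rfl,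
        by simp; omega, hs1, hs2⟩, Or.inl (by omega)⟩
    · obtain ⟨rfl, hF⟩ := hl _ y hb
      obtain ⟨t', ht', h'⟩ := hs2 _ _ hb
      obtain ⟨m, hm'⟩ := M.exists_progress_of_tail ht' (s := s) (p := r ++ q ++ [b])
        (by simpa using h')
      exact ⟨m, hm', Or.inr hF⟩
  choose m hm1 hm2 using key
  refine ⟨fun b => (ρ (q ++ [b]), m b), hm1, fun a' ha' => ?_, hm2⟩
  rw [hs1 q a ha] at ha'
  cases ha'
  rw [← hj]
  exact hρ q a ha

theorem omega_le_infiniteTrees (M : TreeAutomaton A n) :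
    omega (comp (accept A M.final) (plus M.transHom)) ≤ M.infiniteTrees := by
  intro i s hs
  obtain ⟨m, hm⟩ := M.exists_progress_of_tail (s := s) (p := []) hs fun q => rfl
  have hstep : ∀ p c, ∃ d : Bool → Fin n × ℕ, M.Progress s p c →
      (∀ b, M.Progress s (p ++ [b]) (d b)) ∧
      (∀ a, s.label p = some (Sum.inl a) → ((d false).1, (d true).1) ∈ M.δ c.1 a) ∧
      ∀ b, (d b).2 < c.2 ∨ (d b).1 ∈ M.final := fun p c => by
    by_cases h : M.Progress s p c
    · obtain ⟨d, hd⟩ := h.step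
      exact ⟨d, fun _ => hd⟩
    · exact ⟨fun _ => c, fun h' => absurd h' h⟩
  choose d hd using hstep
  -- Children extend words at the end, hence recursion on the reversed word.
  let conf : List Bool → Fin n × ℕ := fun p =>
    p.reverse.rec (i, m) fun b q c => d q.reverse c b
  have conf_append : ∀ p b, conf (p ++ [b]) = d p (conf p) b := by
    intro p b
    simp [conf]
  have hconf : ∀ p, M.Progress s p (conf p) := by
    intro p
    induction p using List.reverseRecOn with
    | nil => exact hm
    | append_singleton p b ih =>
      rw [conf_append]
      exact (hd p _ ih).1 b
  refine ⟨s.isInfinite, fun p => (conf p).1, ⟨rfl, fun p a hp => ?_⟩, fun b => ?_⟩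
  · beta_reduce
    rw [conf_append, conf_append]
    exact (hd p _ (hconf p)).2.1 a hp
  · refine Filter.frequently_atTop.2 fun K => ?_
    by_contra! hK
    -- With no accepting state from depth `K` on, the bound would drop at every step, which is
    -- impossible in ℕ.
    have hdec : ∀ k, (conf ((List.range (K + k)).map b)).2 + k ≤
        (conf ((List.range K).map b)).2 := by
      intro k
      induction k with
      | zero => simp
      | succ k ih =>
        have hF := hK (K + k + 1) (by omega)
        rw [List.range_succ, List.map_append, List.map_singleton, conf_append] at hF
        have := ((hd _ _ (hconf ((List.range (K + k)).map b))).2.2 (b (K + k))).resolve_right hF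
        rw [← add_assoc K, List.range_succ, List.map_append, List.map_singleton, conf_append]
        omega
    have := hdec ((conf ((List.range K).map b)).2 + 1)
    omega

end TreeAutomaton

end TreeTTS

theorem proposition3p2 {A : Type*} {n : ℕ} (M : TreeTTS.TreeAutomaton A n) (i : Fin n) :
    TreeTTS.comp (TreeTTS.bang A (Fin n))
        (TreeTTS.comp (TreeTTS.accept A M.final) (TreeTTS.star M.transHom)) i = M.finiteTrees i ∧
    TreeTTS.omega (TreeTTS.comp (TreeTTS.accept A M.final) (TreeTTS.plus M.transHom)) i =
        M.infiniteTrees i :=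
  ⟨M.comp_bang_accept_star i,
    (M.omega_le_infiniteTrees i).antisymm (TreeTTS.le_omega M.infiniteTrees_le_comp i)⟩
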